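/- Let $K$ be a field and let $\mathcal O=\{\mathcal O(n)\}_{n\ge 0}$ be a (symmetric, unital) operad in $K$-vector spaces. For $\mathcal O$-algebras $A,B$, a measuring $(C,\phi)$ from $A$ to $B$ is a (coassociative, counital) $K$-coalgebra $(C,\Delta,\epsilon)$ with a $K$-linear map $\phi:C\to \mathrm{Hom}_K(A,B)$ such that, for all $c\in C$, $n\ge 1$, $\theta\in\mathcal O(n)$, $a_1,\dots,a_n\in A$ and $\theta_0\in\mathcal O(0)$, $$\phi(c)\big(\theta(a_1\otimes\cdots\otimes a_n)\big)=\sum\theta\big(\phi(c_1)(a_1)\otimes\cdots\otimes\phi(c_n)(a_n)\big),\qquad \phi(c)(u_A(\theta_0))=\epsilon(c)\,u_B(\theta_0),$$ where $\sum c_1\otimes\cdots\otimes c_n$ is the iterated coproduct of $c$ and $u_A:\mathcal O(0)\to A$, $u_B:\mathcal O(0)\to B$ are the arity-zero structure maps. Then for all $\mathcal O$-algebras $A,B$ there are a $K$-coalgebra $\mathcal M(A,B)$ and a measuring $\Phi_{A,B}:\mathcal M(A,B)\to\mathrm{Hom}_K(A,B)$ such that for every measuring $(C,\phi)$ from $A$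 to $B$ there is a unique morphism of coalgebras $\psi:C\to\mathcal M(A,B)$ with $\Phi_{A,B}\circ\psi=\phi$. Moreover, with the $\mathcal M(A,B)$ as Hom-objects, the category of $\mathcal O$-algebras is enriched over the monoidal category of $K$-coalgebras. The composition $\mathcal M(A,B)\otimes\mathcal M(B,D)\to\mathcal M(A,D)$, written $x\otimes y\mapsto x\cdot y$, and the unit $K\to\mathcal M(A,A)$, written $1\mapsto 1_A$, are morphisms of coalgebras satisfying the associativity and unit laws, with $$\Phi_{A,D}(x\cdot y)=\Phi_{B,D}(y)\circ\Phi_{A,B}(x),\qquad \Phi_{A,A}(1_A)=\mathrm{id}_A.$$ The underlying ordinary category is the category of $\mathcal O$-algebras: morphisms $f:A\to B$ of $\mathcal O$-algebras correspond bijectively, compatibly with identities and composition, to coalgebra morphisms $g_f:K\to\mathcal M(A,B)$, with $\Phi_{A,B}(g_f(1))=f$. In particular, for every $A$, the coalgebra $\mathcal M(A,A)$ with the product $x\cdot y$ and the unit $1_A$ is a bialgebra. -/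

import Mathlib

open CategoryTheory MonoidalCategory TensorProduct

universe w u

noncomputable section

/-- A collection `{O(n)}` of `K`-vector spaces, each with a left `K[S_n]`-module structure. -/
structure SymSeq (K : Type u) [Field K] where
  obj : ℕ → Type w
  [addCommGroup : ∀ n, AddCommGroup (obj n)]
  [module : ∀ n, Module K (obj n)]
  /-- the left action of `S_n` on `O(n)` -/
  ρ : ∀ n, Representation K (Equiv.Perm (Fin n)) (obj n)

namespace SymSeq

attribute [instance] SymSeq.addCommGroup SymSeq.module

variable {K : Type u} [Field K] (O : SymSeq.{w} K)

/-- The identification of `O(m)` with `O(n)` for equal numbers `m = n`. -/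
def castArity {m n : ℕ} (h : m = n) : O.obj m → O.obj n := fun θ => h ▸ θ

theorem eq_of_equiv {m n : ℕ} (e : Fin m ≃ Fin n) : m = n := by
  simpa using Fintype.card_congr e

/-- The action on `O` of a bijection `e : Fin m ≃ Fin n`: since `m = n`, it is the action of a
permutation. -/
def relabel {m n : ℕ} (e : Fin m ≃ Fin n) (θ : O.obj m) : O.obj n :=
  O.ρ n ((finCongr (eq_of_equiv e)).symm.trans e) (O.castArity (eq_of_equiv e) θ)

end SymSeq

/-- The direct sum `τ_1 ⊕ ⋯ ⊕ τ_n` of permutations of blocks: it sends the `j`-th element of the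
`i`-th block to the `τ_i(j)`-th element of the `i`-th block. -/
def blockSum {n : ℕ} {k : Fin n → ℕ} (τ : ∀ i, Equiv.Perm (Fin (k i))) :
    Equiv.Perm (Fin (∑ i, k i)) :=
  (finSigmaFinEquiv.symm.trans (Equiv.sigmaCongrRight τ)).trans finSigmaFinEquiv

/-- The block permutation `σ_*(k_1, …, k_n)`: it sends the `j`-th element of the `i`-th block
of `k_{σ(1)} + ⋯ + k_{σ(n)}` to the `j`-th element of the `σ(i)`-th block of `k_1 + ⋯ + k_n`. -/
def blockPerm {n : ℕ} (σ : Equiv.Perm (Fin n)) (k : Fin n → ℕ) :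
    Fin (∑ i, k (σ i)) ≃ Fin (∑ i, k i) :=
  (finSigmaFinEquiv.symm.trans
    (Equiv.sigmaCongrLeft (β := fun i => Fin (k i)) σ)).trans finSigmaFinEquiv

theorem sum_sum_eq_sum_flatten {n : ℕ} (m : Fin n → ℕ) (k : ∀ s, Fin (m s) → ℕ) :
    ∑ r : Fin (∑ s, m s), k (finSigmaFinEquiv.symm r).1 (finSigmaFinEquiv.symm r).2 =
      ∑ s, ∑ t, k s t := by
  rw [Equiv.sum_comp (finSigmaFinEquiv (n := m)).symm (fun x => k x.1 x.2), Fintype.sum_sigma]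

/-- A (symmetric, unital) operad in `K`-vector spaces. -/
structure Operad (K : Type u) [Field K] extends SymSeq.{w} K where
  /-- the composition `γ : O(n) ⊗ O(k_1) ⊗ ⋯ ⊗ O(k_n) → O(k_1 + ⋯ + k_n)`; for `n = 0` it is the
  identity of `O(0)` by `unit_right` -/
  γ : ∀ {n : ℕ} (k : Fin n → ℕ),
    obj n →ₗ[K] MultilinearMap K (fun i => obj (k i)) (obj (∑ i, k i))
  /-- the unit, i.e. the image of `1` under `η : K → O(1)` -/
  one : obj 1
  assoc : ∀ {n : ℕ} (m : Fin n → ℕ) (k : ∀ s, Fin (m s) → ℕ)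
    (θ : obj n) (μ : ∀ s, obj (m s)) (ν : ∀ s t, obj (k s t)),
    toSymSeq.castArity (sum_sum_eq_sum_flatten m k)
      (γ (fun r => k (finSigmaFinEquiv.symm r).1 (finSigmaFinEquiv.symm r).2) (γ m θ μ)
        (fun r => ν (finSigmaFinEquiv.symm r).1 (finSigmaFinEquiv.symm r).2)) =
      γ (fun s => ∑ t, k s t) θ (fun s => γ (k s) (μ s) (ν s))
  equivariance_inner : ∀ {n : ℕ} (m : Fin n → ℕ) (τ : ∀ i, Equiv.Perm (Fin (m i)))
    (θ : obj n) (μ : ∀ i, obj (m i)),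
    γ m θ (fun i => ρ (m i) (τ i) (μ i)) = ρ (∑ i, m i) (blockSum τ) (γ m θ μ)
  equivariance_outer : ∀ {n : ℕ} (m : Fin n → ℕ) (σ : Equiv.Perm (Fin n))
    (θ : obj n) (μ : ∀ i, obj (m i)),
    γ m (ρ n σ θ) μ =
      toSymSeq.relabel (blockPerm σ m) (γ (fun i => m (σ i)) θ (fun i => μ (σ i)))
  unit_right : ∀ {n : ℕ} (θ : obj n),
    toSymSeq.castArity (by simp) (γ (fun _ : Fin n => 1) θ (fun _ => one)) = θ
  unit_left : ∀ {n : ℕ} (θ : obj n),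
    toSymSeq.castArity (by simp) (γ (fun _ : Fin 1 => n) one (fun _ => θ)) = θ

section OperadAlgebra

variable {K : Type u} [Field K]

/-- An algebra over the operad `O`, with structure maps `O(n) ⊗ A^{⊗ n} → A`. -/
structure OperadAlgebra (O : Operad.{w} K) where
  carrier : Type u
  [addCommGroup : AddCommGroup carrier]
  [module : Module K carrier]
  /-- `act n θ a` is `θ(a_1 ⊗ ⋯ ⊗ a_n)` -/
  act : ∀ n : ℕ, O.obj n →ₗ[K] MultilinearMap K (fun _ : Fin n => carrier) carrier
  assoc : ∀ {n : ℕ} (k : Fin n → ℕ) (θ : O.obj n) (μ : ∀ s, O.obj (k s))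
    (a : Fin (∑ s, k s) → carrier),
    act (∑ s, k s) (O.γ k θ μ) a =
      act n θ (fun s => act (k s) (μ s) (fun j => a (finSigmaFinEquiv ⟨s, j⟩)))
  equivariance : ∀ {n : ℕ} (σ : Equiv.Perm (Fin n)) (θ : O.obj n) (a : Fin n → carrier),
    act n (O.ρ n σ θ) a = act n θ (fun i => a (σ i))
  unit : ∀ a : carrier, act 1 O.one (fun _ => a) = a

namespace OperadAlgebra

attribute [instance] OperadAlgebra.addCommGroup OperadAlgebra.module

variable {O : Operad.{w} K}

instance : CoeSort (OperadAlgebra O) (Type u) := ⟨carrier⟩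

/-- The map `u_A : O(0) → A`. -/
def u (A : OperadAlgebra O) (θ : O.obj 0) : A := A.act 0 θ Fin.elim0

/-- A morphism of `O`-algebras. -/
@[ext]
structure Hom (A B : OperadAlgebra O) where
  toLinearMap : A →ₗ[K] B
  map_act : ∀ (n : ℕ) (θ : O.obj n) (a : Fin n → A),
    toLinearMap (A.act n θ a) = B.act n θ (fun i => toLinearMap (a i))

/-- The category of `O`-algebras. -/
instance : Category (OperadAlgebra O) where
  Hom := Hom
  id A := ⟨LinearMap.id, fun _ _ _ => rfl⟩
  comp f g := ⟨g.toLinearMap ∘ₗ f.toLinearMap, fun n θ a => by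
    simp [f.map_act, g.map_act]⟩

end OperadAlgebra

end OperadAlgebra

/-- The linear map `C ⊗ C^{⊗ n} → C^{⊗ (n+1)}`, `c ⊗ (c_1 ⊗ ⋯ ⊗ c_n) ↦ c ⊗ c_1 ⊗ ⋯ ⊗ c_n`. -/
def consTensor (K : Type u) [Field K] (C : Type u) [AddCommGroup C] [Module K C] (n : ℕ) :
    C ⊗[K] (⨂[K]^n C) →ₗ[K] ⨂[K]^(n + 1) C :=
  TensorProduct.lift
    ((PiTensorProduct.lift (R := K) (s := fun _ : Fin n => C)
        (E := ⨂[K]^(n + 1) C)).toLinearMap ∘ₗ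
      (PiTensorProduct.tprod K (s := fun _ : Fin (n + 1) => C)).curryLeft)

/-- The iterated coproduct `C → C^{⊗ n}`, `c ↦ ∑ c_1 ⊗ ⋯ ⊗ c_n`. It is the counit for `n = 0`,
the identity for `n = 1` and the coproduct for `n = 2`. -/
def iterComul (K : Type u) [Field K] (C : Type u) [AddCommGroup C] [Module K C]
    [Coalgebra K C] : ∀ n : ℕ, C →ₗ[K] ⨂[K]^n C
  | 0 => (PiTensorProduct.isEmptyEquiv (R := K) (Fin 0)).symm.toLinearMap ∘ₗ Coalgebra.counit
  | n + 1 => consTensor K C n ∘ₗ (iterComul K C n).lTensor C ∘ₗ Coalgebra.comul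

section Measuring

variable {K : Type u} [Field K] {O : Operad.{w} K}

/-- `(C, φ)` is a measuring from `A` to `B`. In `map_act`, the right-hand side is
`∑ θ(φ(c_1)(a_1) ⊗ ⋯ ⊗ φ(c_n)(a_n))`: the linear map `C^{⊗ n} → B` induced by
`(c_1, …, c_n) ↦ θ(φ(c_1)(a_1), …, φ(c_n)(a_n))` is applied to the iterated coproduct of `c`. -/
structure IsMeasuring (A B : OperadAlgebra O) {C : Type u} [AddCommGroup C] [Module K C]
    [Coalgebra K C] (φ : C →ₗ[K] A →ₗ[K] B) : Prop where
  map_act : ∀ n : ℕ, 1 ≤ n → ∀ (c : C) (θ : O.obj n) (a : Fin n → A),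
    φ c (A.act n θ a) =
      PiTensorProduct.lift ((B.act n θ).compLinearMap (fun i => φ.flip (a i)))
        (iterComul K C n c)
  map_u : ∀ (c : C) (θ : O.obj 0), φ c (A.u θ) = (Coalgebra.counit c : K) • B.u θ

/-- `(M, Φ)` is a universal measuring from `A` to `B`: every measuring `(C, φ)` factors through
`Φ` by a unique morphism of coalgebras `C → M`. -/
structure IsUniversalMeasuring (A B : OperadAlgebra O) {M : Type u} [AddCommGroup M]
    [Module K M] [Coalgebra K M] (Φ : M →ₗ[K] A →ₗ[K] B) : Prop where
  isMeasuring : IsMeasuring A B Φ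
  existsUnique : ∀ (C : Type u) [AddCommGroup C] [Module K C] [Coalgebra K C]
    (φ : C →ₗ[K] A →ₗ[K] B), IsMeasuring A B φ →
      ∃! ψ : C →ₗc[K] M, Φ ∘ₗ (ψ : C →ₗ[K] M) = φ

end Measuring

end

noncomputable section

open Coalgebra (comul counit)

namespace UniversalMeasuring

/-! ### Coideals and the largest coideal in a kernel. -/

section Coideals

variable {K : Type*} [Field K] {C D V : Type*}
  [AddCommGroup C] [Module K C] [Coalgebra K C]
  [AddCommGroup D] [Module K D] [Coalgebra K D] [AddCommGroup V] [Module K V]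

/-! Two coalgebra maps differ by a map whose range is a coideal, so if the kernel of Φ : D → V
contains no nonzero coideal, maps into D are determined by their composites with Φ. A sum of
coideals is a coideal, so dividing by the largest coideal in the kernel of any linear map enforces
this property.

The universal measuring is obtained by dividing the direct sum of all measurings by coalgebras of
countable dimension in this way. Such coalgebras are taken as quotients of `ℕ →₀ K`, so the sum
stays in the universe of `K`. They suffice because every element of a coalgebra lies in a
countable-dimensional subcoalgebra. The corresponding maps on these pieces are glued in
`existsUnique_coalgHom`: divide C ⊕ D by the largest coideal in the kernel of the combined map to V;
D maps isomorphically onto the quotient, and C maps to it.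

The enrichment is then formal. If φ and ψ are measurings, so is x ⊗ y ↦ ψ(y) ∘ φ(x), which induces
the composition. Every law is an equality of coalgebra maps into some M(A, B), hence reduces to a
law for linear maps after evaluation. -/

theorem map_self_injective {U W : Type*} [AddCommGroup U] [Module K U] [AddCommGroup W]
    [Module K W] {f : U →ₗ[K] W} (hf : Function.Injective f) :
    Function.Injective (TensorProduct.map f f) :=
  TensorProduct.map_injective_of_flat_flat _ _ hf hf

/-- A submodule is a coideal if it is contained in the kernel of the counit and in the kernel of
the comultiplication followed by the tensor square of some linear map whose kernel it contains. -/
theorem isCoideal_of_ker_le {I : Submodule K C} {W : Type*} [AddCommGroup W] [Module K W]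
    (p : C →ₗ[K] W) (hp : LinearMap.ker p ≤ I) (hε : ∀ x ∈ I, counit (R := K) x = 0)
    (hΔ : ∀ x ∈ I, TensorProduct.map p p (comul x) = 0) : I.IsCoideal := by
  refine ⟨fun x hx => hε x hx, fun x hx => ?_⟩
  -- C/ker p embeds in W, hence so do the tensor squares over a field: the hypothesis already holds
  -- in C/ker p, of which C/I is a quotient.
  have hinj : Function.Injective ((LinearMap.ker p).liftQ p le_rfl) :=
    LinearMap.ker_eq_bot.1 (Submodule.ker_liftQ_eq_bot _ _ _ le_rfl)
  have h : TensorProduct.map (LinearMap.ker p).mkQ (LinearMap.ker p).mkQ (comul x) = 0 := by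
    apply map_self_injective hinj
    rw [TensorProduct.map_map, Submodule.liftQ_mkQ, hΔ x hx, map_zero]
  have h2 : I.mkQ = Submodule.factor hp ∘ₗ (LinearMap.ker p).mkQ := rfl
  rw [h2, ← TensorProduct.map_map, h, map_zero]

theorem isCoideal_ker (f : C →ₗc[K] D) : (LinearMap.ker (f : C →ₗ[K] D)).IsCoideal := by
  refine isCoideal_of_ker_le (f : C →ₗ[K] D) le_rfl (fun x hx => ?_) (fun x hx => ?_)
  · have hx : f x = 0 := hx
    rw [← CoalgHomClass.counit_comp_apply f x, hx, map_zero]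
  · have hx : f x = 0 := hx
    have := CoalgHomClass.map_comp_comul_apply f x
    rw [hx, map_zero] at this
    exact this

/-- Modulo the range I, f and g agree, so the images of Δ(f c) and Δ(g c) in the tensor square of
D/I are both the image of Δ(c) under the same map. -/
theorem isCoideal_range_sub (f g : C →ₗc[K] D) :
    (LinearMap.range ((f : C →ₗ[K] D) - (g : C →ₗ[K] D))).IsCoideal := by
  refine ⟨?_, ?_⟩
  · rintro _ ⟨c, rfl⟩
    simp
  · rintro _ ⟨c, rfl⟩
    set I := LinearMap.range ((f : C →ₗ[K] D) - (g : C →ₗ[K] D))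
    have h : I.mkQ ∘ₗ (f : C →ₗ[K] D) = I.mkQ ∘ₗ (g : C →ₗ[K] D) := by
      ext x
      exact (Submodule.Quotient.eq I).2 ⟨x, rfl⟩
    have hf := CoalgHomClass.map_comp_comul_apply f c
    have hg := CoalgHomClass.map_comp_comul_apply g c
    rw [LinearMap.sub_apply, map_sub, map_sub, sub_eq_zero]
    change TensorProduct.map I.mkQ I.mkQ (comul (f c)) = TensorProduct.map I.mkQ I.mkQ (comul (g c))
    rw [← hf, ← hg, TensorProduct.map_map, TensorProduct.map_map, h]

/-- Both coideal conditions for the sum define submodules, so they can be checked on each summand I,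
where the quotient by the sum factors through the quotient by I. -/
theorem isCoideal_sSup {S : Set (Submodule K C)} (hS : ∀ I ∈ S, I.IsCoideal) :
    (sSup S).IsCoideal := by
  have h : sSup S ≤ LinearMap.ker (counit (R := K) (A := C)) ⊓
      LinearMap.ker (TensorProduct.map (sSup S).mkQ (sSup S).mkQ ∘ₗ comul) := by
    refine sSup_le fun I hI x hx => ⟨(hS I hI).counit_eq_zero hx, ?_⟩
    have h2 : (sSup S).mkQ = Submodule.factor (le_sSup hI) ∘ₗ I.mkQ := rfl
    change TensorProduct.map (sSup S).mkQ (sSup S).mkQ (comul x) = 0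
    rw [h2, ← TensorProduct.map_map,
      (hS I hI).map_mkQ_comul_eq_zero hx, map_zero]
  exact ⟨fun x hx => (h hx).1, fun x hx => (h hx).2⟩

/-- The largest coideal contained in the kernel of a linear map. -/
def maxCoideal (φ : C →ₗ[K] V) : Submodule K C :=
  sSup {I | I.IsCoideal ∧ I ≤ LinearMap.ker φ}

instance isCoideal_maxCoideal (φ : C →ₗ[K] V) : (maxCoideal φ).IsCoideal :=
  isCoideal_sSup fun _ hI => hI.1

theorem maxCoideal_le_ker (φ : C →ₗ[K] V) : maxCoideal φ ≤ LinearMap.ker φ :=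
  sSup_le fun _ hI => hI.2

theorem le_maxCoideal {φ : C →ₗ[K] V} {I : Submodule K C} (hI : I.IsCoideal)
    (h : I ≤ LinearMap.ker φ) : I ≤ maxCoideal φ :=
  le_sSup ⟨hI, h⟩

/-- The linear map induced by `φ` on the quotient by the largest coideal in its kernel. -/
def maxCoidealLift (φ : C →ₗ[K] V) : C ⧸ maxCoideal φ →ₗ[K] V :=
  (maxCoideal φ).liftQ φ (maxCoideal_le_ker φ)

theorem maxCoidealLift_comp_mkQ (φ : C →ₗ[K] V) :
    maxCoidealLift φ ∘ₗ (Coalgebra.Quotient.mkQCoalgHom (R := K) (maxCoideal φ) : C →ₗ[K] _) = φ :=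
  Submodule.liftQ_mkQ _ _ _

/-- A coideal in the new kernel gives a further quotient; the kernel of the composite quotient map
is a coideal inside ker φ, hence was already divided out. -/
theorem maxCoideal_maxCoidealLift (φ : C →ₗ[K] V) : maxCoideal (maxCoidealLift φ) = ⊥ := by
  set I := maxCoideal (maxCoidealLift φ)
  let f : C →ₗc[K] ((C ⧸ maxCoideal φ) ⧸ I) :=
    (Coalgebra.Quotient.mkQCoalgHom I).comp (Coalgebra.Quotient.mkQCoalgHom (maxCoideal φ))
  have hf : LinearMap.ker (f : C →ₗ[K] ((C ⧸ maxCoideal φ) ⧸ I)) ≤ maxCoideal φ := by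
    refine le_maxCoideal (isCoideal_ker f) fun x hx => ?_
    have hx : Submodule.Quotient.mk (p := I) (Submodule.Quotient.mk (p := maxCoideal φ) x) = 0 := hx
    exact maxCoidealLift φ |>.mem_ker.1 (maxCoideal_le_ker _ ((Submodule.Quotient.mk_eq_zero I).1 hx))
  refine eq_bot_iff.2 fun y hy => ?_
  obtain ⟨x, rfl⟩ := Submodule.Quotient.mk_surjective _ y
  exact (Submodule.Quotient.mk_eq_zero _).2 (hf ((Submodule.Quotient.mk_eq_zero I).2 hy))

theorem coalgHom_eq_of_comp_eq {Φ : D →ₗ[K] V} (hΦ : maxCoideal Φ = ⊥) {f g : C →ₗc[K] D}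
    (h : Φ ∘ₗ (f : C →ₗ[K] D) = Φ ∘ₗ (g : C →ₗ[K] D)) : f = g := by
  have h2 := le_maxCoideal (φ := Φ) (isCoideal_range_sub f g) (by
    rintro _ ⟨c, rfl⟩
    simpa [sub_eq_zero] using LinearMap.congr_fun h c)
  ext c
  have : f c - g c ∈ (⊥ : Submodule K D) := hΦ ▸ h2 ⟨c, rfl⟩
  exact sub_eq_zero.1 this

/-- The kernel of f is a coideal contained in ker Φ, hence zero. -/
theorem injective_of_comp_eq {Φ : D →ₗ[K] V} (hΦ : maxCoideal Φ = ⊥) (f : D →ₗc[K] C)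
    {φ : C →ₗ[K] V} (h : φ ∘ₗ (f : D →ₗ[K] C) = Φ) : Function.Injective f := by
  have h2 := le_maxCoideal (φ := Φ) (isCoideal_ker f) (by
    intro x hx
    rw [← h, LinearMap.mem_ker, LinearMap.comp_apply, LinearMap.mem_ker.1 hx, map_zero])
  rw [hΦ] at h2
  exact LinearMap.ker_eq_bot.1 (eq_bot_iff.2 h2)

/-! ### Direct sums of coalgebras and gluing of coalgebra maps. -/

section Inclusions

variable (K C D) in
/-- The left inclusion into the direct sum of two coalgebras. -/
def inlCoalgHom : C →ₗc[K] C × D :=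
  ⟨LinearMap.inl K C D, Prod.counit_comp_inl K C D, (Prod.comul_comp_inl K C D).symm⟩

variable (K C D) in
/-- The right inclusion into the direct sum of two coalgebras. -/
def inrCoalgHom : D →ₗc[K] C × D :=
  ⟨LinearMap.inr K C D, Prod.counit_comp_inr K C D, (Prod.comul_comp_inr K C D).symm⟩

variable {ι : Type*} [DecidableEq ι] (E : ι → Type*) [∀ i, AddCommGroup (E i)]
  [∀ i, Module K (E i)] [∀ i, Coalgebra K (E i)]

/-- The inclusion of a summand into a direct sum of coalgebras. -/
def lsingleCoalgHom (i : ι) : E i →ₗc[K] Π₀ i, E i :=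
  ⟨DFinsupp.lsingle i, DFinsupp.counit_comp_lsingle K ι E i,
    (DFinsupp.comul_comp_lsingle K ι E i).symm⟩

end Inclusions

/-- Let every element of `C` be in the image of a coalgebra map `f : E i → C` that is compatible
with the maps to `V` and such that `E i` has a map to `D` over `V`. If the kernel of `D → V`
contains no nonzero coideal, then there is a unique coalgebra map `C → D` over `V`. -/
theorem existsUnique_coalgHom {ι : Type*} {E : ι → Type*} [∀ i, AddCommGroup (E i)]
    [∀ i, Module K (E i)] [∀ i, Coalgebra K (E i)] {Φ : D →ₗ[K] V} (hΦ : maxCoideal Φ = ⊥)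
    (g : ∀ i, E i →ₗc[K] D) {φ : C →ₗ[K] V}
    (hφ : ∀ c, ∃ (i : ι) (f : E i →ₗc[K] C), c ∈ Set.range f ∧
      φ ∘ₗ (f : E i →ₗ[K] C) = Φ ∘ₗ (g i : E i →ₗ[K] D)) :
    ∃! ψ : C →ₗc[K] D, Φ ∘ₗ (ψ : C →ₗ[K] D) = φ := by
  let χ : C × D →ₗ[K] V := φ.coprod Φ
  let π := Coalgebra.Quotient.mkQCoalgHom (R := K) (maxCoideal χ)
  let p : C →ₗc[K] _ := π.comp (inlCoalgHom K C D)
  let q : D →ₗc[K] _ := π.comp (inrCoalgHom K C D)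
  have hp : maxCoidealLift χ ∘ₗ (p : C →ₗ[K] _) = φ := by
    ext c
    change χ (c, 0) = φ c
    simp [χ]
  have hq : maxCoidealLift χ ∘ₗ (q : D →ₗ[K] _) = Φ := by
    ext d
    change χ (0, d) = Φ d
    simp [χ]
  have hχ := maxCoideal_maxCoidealLift χ
  -- For c = f(x), the two maps from E i to the quotient, through C and through D, agree over V and
  -- hence are equal.
  have hpq : ∀ c, p c ∈ LinearMap.range (q : D →ₗ[K] _) := by
    intro c
    obtain ⟨i, f, ⟨x, rfl⟩, hf⟩ := hφ c
    have : p.comp f = q.comp (g i) := coalgHom_eq_of_comp_eq hχ (by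
      rw [CoalgHom.comp_toLinearMap p f, CoalgHom.comp_toLinearMap q (g i),
        ← LinearMap.comp_assoc, hp, ← LinearMap.comp_assoc, hq, hf])
    exact ⟨g i x, (CoalgHom.congr_fun this x).symm⟩
  -- The quotient is the sum of the images of C and D, and the first is contained in the second. So
  -- C → D is p followed by the inverse of q.
  have hbij : Function.Bijective q := by
    refine ⟨injective_of_comp_eq hΦ q hq, fun y => ?_⟩
    obtain ⟨⟨c, d⟩, rfl⟩ := Submodule.Quotient.mk_surjective _ y
    obtain ⟨d', hd'⟩ := hpq c
    refine ⟨d' + d, ?_⟩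
    have hd' : q d' = p c := hd'
    rw [map_add, hd']
    change π (c, 0) + π (0, d) = π (c, d)
    rw [← map_add]
    simp
  let e := CoalgEquiv.ofBijective hbij
  refine ⟨(e.symm : _ →ₗc[K] D).comp p, ?_, fun ψ hψ => ?_⟩
  · ext c
    have : q (e.symm (p c)) = p c := e.apply_symm_apply (p c)
    calc Φ (e.symm (p c)) = maxCoidealLift χ (q (e.symm (p c))) :=
          (LinearMap.congr_fun hq _).symm
      _ = φ c := by rw [this]; exact LinearMap.congr_fun hp c
  · refine coalgHom_eq_of_comp_eq hΦ (hψ.trans ?_)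
    ext c
    have : q (e.symm (p c)) = p c := e.apply_symm_apply (p c)
    calc φ c = maxCoidealLift χ (q (e.symm (p c))) := by
          rw [this]; exact (LinearMap.congr_fun hp c).symm
      _ = Φ (e.symm (p c)) := LinearMap.congr_fun hq _

/-! ### Subcoalgebras of countable dimension. -/

section Subcoalgebra

variable {U : Type*} [AddCommGroup U] [Module K U] {j : U →ₗ[K] C}

/-- The coalgebra structure on a subspace `j : U → C` such that `Δ(U)` is contained in `U ⊗ U`. -/
@[reducible]
def ofInjective (hj : Function.Injective j)
    (h : LinearMap.range (comul ∘ₗ j) ≤ LinearMap.range (TensorProduct.map j j)) :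
    Coalgebra K U :=
  let Δ : U →ₗ[K] U ⊗[K] U :=
    (LinearEquiv.ofInjective _ (map_self_injective hj)).symm.toLinearMap ∘ₗ
      (comul ∘ₗ j).codRestrict _ (fun x => h ⟨x, rfl⟩)
  have hΔ : TensorProduct.map j j ∘ₗ Δ = comul ∘ₗ j := by
    ext x
    exact congrArg Subtype.val ((LinearEquiv.ofInjective _ (map_self_injective hj)).apply_symm_apply
      ⟨comul (j x), h ⟨x, rfl⟩⟩)
  have hΔ' (x : U) : TensorProduct.map j j (Δ x) = comul (j x) := LinearMap.congr_fun hΔ x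
  { comul := Δ
    counit := counit ∘ₗ j
    coassoc := by
      -- Coassociativity is tested after the injection into C ⊗ (C ⊗ C), where it is that of C; the
      -- counit laws are treated likewise.
      have hinj : Function.Injective (TensorProduct.map j (TensorProduct.map j j)) :=
        TensorProduct.map_injective_of_flat_flat _ _ hj (map_self_injective hj)
      rw [← LinearMap.cancel_left hinj]
      have h₁ : TensorProduct.map j (TensorProduct.map j j) ∘ₗ Δ.lTensor U =
          comul.lTensor C ∘ₗ TensorProduct.map j j :=
        TensorProduct.ext' fun x y => by simp [hΔ']
      have h₂ : TensorProduct.map (TensorProduct.map j j) j ∘ₗ Δ.rTensor U =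
          comul.rTensor C ∘ₗ TensorProduct.map j j :=
        TensorProduct.ext' fun x y => by simp [hΔ']
      ext x
      have h₃ := LinearMap.congr_fun (TensorProduct.map_map_comp_assoc_eq j j j)
        (Δ.rTensor U (Δ x))
      have h₄ := LinearMap.congr_fun h₁ (Δ x)
      have h₅ := LinearMap.congr_fun h₂ (Δ x)
      simp only [LinearMap.comp_apply, LinearEquiv.coe_coe] at h₃ h₄ h₅ ⊢
      rw [h₃, h₄, h₅, hΔ', Coalgebra.coassoc_apply]
    rTensor_counit_comp_comul := by
      have hinj : Function.Injective (j.lTensor K) :=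
        Module.Flat.lTensor_preserves_injective_linearMap j hj
      have h₁ : j.lTensor K ∘ₗ (counit ∘ₗ j).rTensor U =
          (counit (R := K)).rTensor C ∘ₗ TensorProduct.map j j :=
        TensorProduct.ext' fun x y => by simp
      rw [← LinearMap.cancel_left hinj, ← LinearMap.comp_assoc, h₁, LinearMap.comp_assoc, hΔ,
        ← LinearMap.comp_assoc, Coalgebra.rTensor_counit_comp_comul]
      rfl
    lTensor_counit_comp_comul := by
      have hinj : Function.Injective (j.rTensor K) :=
        Module.Flat.rTensor_preserves_injective_linearMap j hj
      have h₁ : j.rTensor K ∘ₗ (counit ∘ₗ j).lTensor U =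
          (counit (R := K)).lTensor C ∘ₗ TensorProduct.map j j :=
        TensorProduct.ext' fun x y => by simp
      rw [← LinearMap.cancel_left hinj, ← LinearMap.comp_assoc, h₁, LinearMap.comp_assoc, hΔ,
        ← LinearMap.comp_assoc, Coalgebra.lTensor_counit_comp_comul]
      rfl }

end Subcoalgebra

/-- Each coproduct involves finitely many tensor factors, so adjoining them repeatedly, starting
from c, gives a countable set. The sequence s enumerates it, and its span is a subcoalgebra. -/
theorem exists_countable_subcoalgebra (c : C) : ∃ s : ℕ → C, c ∈ Set.range s ∧ ∀ n,
    comul (R := K) (s n) ∈ LinearMap.range (TensorProduct.map (Finsupp.linearCombination K s)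
      (Finsupp.linearCombination K s)) := by
  have hF : ∀ x : C, ∃ F : Finset (C × C), comul (R := K) x = ∑ i ∈ F, i.1 ⊗ₜ[K] i.2 :=
    fun x => TensorProduct.exists_finset _
  choose F hF using hF
  let T : ℕ → Set C := fun n => Nat.rec {c}
    (fun _ S => ⋃ x ∈ S, Prod.fst '' (F x : Set (C × C)) ∪ Prod.snd '' (F x : Set (C × C))) n
  have hT : ∀ n, (T n).Countable := by
    intro n
    induction n with
    | zero => exact Set.countable_singleton c
    | succ n ih =>
      exact ih.biUnion fun x _ => (((F x).countable_toSet.image _).union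
        ((F x).countable_toSet.image _))
  have hc : c ∈ ⋃ n, T n := Set.mem_iUnion.2 ⟨0, rfl⟩
  obtain ⟨s, hs⟩ := (Set.countable_iUnion hT).exists_eq_range ⟨c, hc⟩
  refine ⟨s, hs ▸ hc, fun n => ?_⟩
  rw [hF]
  obtain ⟨m, hm⟩ := Set.mem_iUnion.1 (hs ▸ Set.mem_range_self n : s n ∈ ⋃ n, T n)
  have key : ∀ x ∈ T (m + 1), ∃ y, Finsupp.linearCombination K s y = x := by
    intro x hx
    have : x ∈ Set.range s := hs ▸ Set.mem_iUnion.2 ⟨m + 1, hx⟩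
    obtain ⟨k, rfl⟩ := this
    exact ⟨Finsupp.single k 1, by simp⟩
  refine Submodule.sum_mem _ fun i hi => ?_
  obtain ⟨y, hy⟩ := key i.1 (Set.mem_biUnion hm (Or.inl ⟨i, hi, rfl⟩))
  obtain ⟨z, hz⟩ := key i.2 (Set.mem_biUnion hm (Or.inr ⟨i, hi, rfl⟩))
  exact ⟨y ⊗ₜ z, by rw [TensorProduct.map_tmul, hy, hz]⟩

/-- Every element of a coalgebra is in the image of a coalgebra of countable dimension. -/
theorem exists_coalgHom_of_countable (c : C) : ∃ (N : Submodule K (ℕ →₀ K))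
    (_ : Coalgebra K ((ℕ →₀ K) ⧸ N)) (f : ((ℕ →₀ K) ⧸ N) →ₗc[K] C), c ∈ Set.range f := by
  obtain ⟨s, ⟨k, rfl⟩, hs⟩ := exists_countable_subcoalgebra (K := K) c
  set l := Finsupp.linearCombination K s
  let j := (LinearMap.ker l).liftQ l le_rfl
  have hj : Function.Injective j := LinearMap.ker_eq_bot.1 (Submodule.ker_liftQ_eq_bot _ _ _ le_rfl)
  have h : LinearMap.range (comul ∘ₗ j) ≤ LinearMap.range (TensorProduct.map j j) := by
    rintro _ ⟨x, rfl⟩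
    obtain ⟨x, rfl⟩ := Submodule.Quotient.mk_surjective _ x
    change comul (l x) ∈ _
    induction x using Finsupp.induction_linear with
    | zero => simp
    | add x y hx hy => rw [map_add, map_add]; exact add_mem hx hy
    | single n a =>
      obtain ⟨t, ht⟩ := hs n
      refine ⟨a • TensorProduct.map (LinearMap.ker l).mkQ (LinearMap.ker l).mkQ t, ?_⟩
      rw [map_smul, TensorProduct.map_map, Submodule.liftQ_mkQ, ht]
      simp [l]
  let _ := ofInjective hj h
  refine ⟨_, ofInjective hj h, ⟨j, rfl, ?_⟩, Submodule.Quotient.mk (Finsupp.single k 1), ?_⟩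
  · ext x
    exact congrArg Subtype.val ((LinearEquiv.ofInjective _ (map_self_injective hj)).apply_symm_apply
      ⟨comul (j (Submodule.Quotient.mk (Finsupp.single x 1))), h ⟨_, rfl⟩⟩)
  · change l _ = _
    simp [l]

end Coideals

/-! ### Iterated coproducts under coalgebra maps, on tensor products and on the trivial coalgebra.
-/

section IterComul

variable {K : Type u} [Field K] {C D : Type u} [AddCommGroup C] [Module K C]
  [AddCommGroup D] [Module K D]

theorem consTensor_tmul_tprod {n : ℕ} (c : C) (v : Fin n → C) :
    consTensor K C n (c ⊗ₜ PiTensorProduct.tprod K v) =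
      PiTensorProduct.tprod K (Fin.cons c v : Fin (n + 1) → C) := by
  simp [consTensor]

theorem map_consTensor_tmul (f : C →ₗ[K] D) {n : ℕ} (c : C) (t : ⨂[K]^n C) :
    PiTensorProduct.map (fun _ => f) (consTensor K C n (c ⊗ₜ t)) =
      consTensor K D n (f c ⊗ₜ PiTensorProduct.map (fun _ => f) t) := by
  induction t using PiTensorProduct.induction_on with
  | smul_tprod r v =>
    simp only [TensorProduct.tmul_smul, map_smul, consTensor_tmul_tprod, PiTensorProduct.map_tprod]
    congr 2
    funext i
    refine Fin.cases ?_ (fun i => ?_) i <;> rfl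
  | add s t hs ht => simp only [TensorProduct.tmul_add, map_add, hs, ht]

theorem map₂_consTensor_tmul {n : ℕ} (c : C) (d : D) (s : ⨂[K]^n C) (t : ⨂[K]^n D) :
    PiTensorProduct.map₂ (fun _ => TensorProduct.mk K C D) (consTensor K C n (c ⊗ₜ s))
        (consTensor K D n (d ⊗ₜ t)) =
      consTensor K (C ⊗[K] D) n
        ((c ⊗ₜ d) ⊗ₜ PiTensorProduct.map₂ (fun _ => TensorProduct.mk K C D) s t) := by
  induction s using PiTensorProduct.induction_on with
  | smul_tprod r v =>
    induction t using PiTensorProduct.induction_on with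
    | smul_tprod r v =>
      simp only [TensorProduct.tmul_smul, map_smul, LinearMap.smul_apply, consTensor_tmul_tprod,
        PiTensorProduct.map₂_tprod_tprod]
      congr 3
      funext i
      refine Fin.cases ?_ (fun i => ?_) i <;> rfl
    | add s t hs ht => simp only [TensorProduct.tmul_add, map_add, hs, ht]
  | add s t hs ht => simp only [TensorProduct.tmul_add, map_add, LinearMap.add_apply, hs, ht]

variable [Coalgebra K C] [Coalgebra K D]

theorem iterComul_zero_apply (c : C) :
    iterComul K C 0 c = (counit c : K) • PiTensorProduct.tprod K Fin.elim0 := by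
  change (PiTensorProduct.isEmptyEquiv (R := K) (Fin 0)).symm (counit c) = _
  rw [PiTensorProduct.isEmptyEquiv_symm_apply]
  exact congrArg _ (congrArg _ (Subsingleton.elim _ _))

theorem iterComul_succ_apply (n : ℕ) (c : C) :
    iterComul K C (n + 1) c = consTensor K C n ((iterComul K C n).lTensor C (comul c)) := rfl

theorem iterComul_coalgHom (f : C →ₗc[K] D) (n : ℕ) (c : C) :
    iterComul K D n (f c) =
      PiTensorProduct.map (fun _ => (f : C →ₗ[K] D)) (iterComul K C n c) := by
  induction n generalizing c with
  | zero =>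
    rw [iterComul_zero_apply, iterComul_zero_apply, CoalgHomClass.counit_comp_apply, map_smul,
      PiTensorProduct.map_tprod]
    congr 2
    exact Subsingleton.elim _ _
  | succ n ih =>
    rw [iterComul_succ_apply, iterComul_succ_apply, ← CoalgHomClass.map_comp_comul_apply f c]
    generalize comul (R := K) c = t
    induction t with
    | zero => simp only [map_zero]
    | add s t hs ht => simp only [map_add, hs, ht]
    | tmul x y =>
      rw [TensorProduct.map_tmul, LinearMap.lTensor_tmul, LinearMap.lTensor_tmul,
        map_consTensor_tmul, ← ih]
      rfl

theorem iterComul_tmul (n : ℕ) (c : C) (d : D) :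
    iterComul K (C ⊗[K] D) n (c ⊗ₜ d) =
      PiTensorProduct.map₂ (fun _ => TensorProduct.mk K C D) (iterComul K C n c)
        (iterComul K D n d) := by
  induction n generalizing c d with
  | zero =>
    rw [iterComul_zero_apply, iterComul_zero_apply, iterComul_zero_apply, map_smul, map_smul,
      LinearMap.smul_apply, PiTensorProduct.map₂_tprod_tprod, smul_smul,
      TensorProduct.counit_tmul, smul_eq_mul]
    congr 2
    exact Subsingleton.elim _ _
  | succ n ih =>
    rw [iterComul_succ_apply, iterComul_succ_apply, iterComul_succ_apply,
      TensorProduct.comul_tmul]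
    generalize comul (R := K) c = s
    generalize comul (R := K) d = t
    induction s with
    | zero => simp only [TensorProduct.zero_tmul, map_zero, LinearMap.zero_apply]
    | add s s' hs hs' => simp only [TensorProduct.add_tmul, map_add, LinearMap.add_apply, hs, hs']
    | tmul c₁ c₂ =>
      induction t with
      | zero => simp only [TensorProduct.tmul_zero, map_zero]
      | add t t' ht ht' => simp only [TensorProduct.tmul_add, map_add, ht, ht']
      | tmul d₁ d₂ =>
        rw [LinearMap.lTensor_tmul, LinearMap.lTensor_tmul, map₂_consTensor_tmul, ← ih]
        rfl

theorem iterComul_one (n : ℕ) :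
    iterComul K K n 1 = PiTensorProduct.tprod K (fun _ => (1 : K)) := by
  induction n with
  | zero =>
    rw [iterComul_zero_apply, CommSemiring.counit_apply, one_smul]
    congr 1
    exact Subsingleton.elim _ _
  | succ n ih =>
    rw [iterComul_succ_apply, CommSemiring.comul_apply, LinearMap.lTensor_tmul, ih,
      consTensor_tmul_tprod]
    congr 1
    funext i
    refine Fin.cases ?_ (fun i => ?_) i <;> rfl

end IterComul

/-! ### Restriction and composition of measurings. -/

section Measurings

variable {K : Type u} [Field K] {O : Operad.{w} K} {A B F : OperadAlgebra O}
  {C D : Type u} [AddCommGroup C] [Module K C] [Coalgebra K C]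
  [AddCommGroup D] [Module K D] [Coalgebra K D]

/-- The linear map `c_1 ⊗ ⋯ ⊗ c_n ↦ θ(φ(c_1)(a_1), …, φ(c_n)(a_n))`. -/
def actTensor (φ : C →ₗ[K] A →ₗ[K] B) {n : ℕ} (θ : O.obj n) (a : Fin n → A) : ⨂[K]^n C →ₗ[K] B :=
  PiTensorProduct.lift ((B.act n θ).compLinearMap (fun i => φ.flip (a i)))

omit [Coalgebra K C] in
theorem actTensor_tprod (φ : C →ₗ[K] A →ₗ[K] B) {n : ℕ} (θ : O.obj n) (a : Fin n → A)
    (c : Fin n → C) :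
    actTensor φ θ a (PiTensorProduct.tprod K c) = B.act n θ (fun i => φ (c i) (a i)) := by
  simp [actTensor]

omit [Coalgebra K C] [Coalgebra K D] in
theorem actTensor_map (φ : C →ₗ[K] A →ₗ[K] B) (f : D →ₗ[K] C) {n : ℕ} (θ : O.obj n)
    (a : Fin n → A) (t : ⨂[K]^n D) :
    actTensor φ θ a (PiTensorProduct.map (fun _ => f) t) = actTensor (φ ∘ₗ f) θ a t := by
  induction t using PiTensorProduct.induction_on with
  | smul_tprod r v =>
    simp only [map_smul, PiTensorProduct.map_tprod, actTensor_tprod, LinearMap.comp_apply]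
  | add s t hs ht => simp only [map_add, hs, ht]

/-- A family of measurings that jointly maps onto `(C, φ)` makes it a measuring. -/
theorem isMeasuring_of_forall_mem_span {φ : C →ₗ[K] A →ₗ[K] B} {S : Set C}
    (hS : Submodule.span K S = ⊤)
    (h : ∀ c ∈ S, ∃ (E : Type u) (_ : AddCommGroup E) (_ : Module K E) (_ : Coalgebra K E)
      (f : E →ₗc[K] C), c ∈ Set.range f ∧ IsMeasuring A B (φ ∘ₗ (f : E →ₗ[K] C))) :
    IsMeasuring A B φ := by
  constructor
  · intro n hn c θ a
    change φ c (A.act n θ a) = actTensor φ θ a (iterComul K C n c)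
    have hc : c ∈ Submodule.span K S := hS ▸ Submodule.mem_top
    induction hc using Submodule.span_induction with
    | zero => simp only [map_zero, LinearMap.zero_apply]
    | add x y _ _ hx hy => simp only [map_add, LinearMap.add_apply, hx, hy]
    | smul r x _ hx => simp only [map_smul, LinearMap.smul_apply, hx]
    | mem c hc =>
      obtain ⟨E, _, _, _, f, ⟨x, rfl⟩, hf⟩ := h c hc
      rw [iterComul_coalgHom, actTensor_map]
      exact hf.map_act n hn x θ a
  · intro c θ
    have hc : c ∈ Submodule.span K S := hS ▸ Submodule.mem_top
    induction hc using Submodule.span_induction with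
    | zero => simp only [map_zero, LinearMap.zero_apply, zero_smul]
    | add x y _ _ hx hy => simp only [map_add, LinearMap.add_apply, hx, hy, add_smul]
    | smul r x _ hx => simp only [map_smul, LinearMap.smul_apply, hx, smul_smul, smul_eq_mul]
    | mem c hc =>
      obtain ⟨E, _, _, _, f, ⟨x, rfl⟩, hf⟩ := h c hc
      rw [CoalgHomClass.counit_comp_apply]
      exact hf.map_u x θ

theorem _root_.IsMeasuring.comp_coalgHom {φ : C →ₗ[K] A →ₗ[K] B} (hφ : IsMeasuring A B φ)
    (f : D →ₗc[K] C) : IsMeasuring A B (φ ∘ₗ (f : D →ₗ[K] C)) := by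
  constructor
  · intro n hn d θ a
    change φ (f d) (A.act n θ a) = actTensor (φ ∘ₗ (f : D →ₗ[K] C)) θ a (iterComul K D n d)
    rw [← actTensor_map, ← iterComul_coalgHom]
    exact hφ.map_act n hn (f d) θ a
  · intro d θ
    rw [← CoalgHomClass.counit_comp_apply f d]
    exact hφ.map_u (f d) θ

/-- The linear map `x ⊗ y ↦ ψ(y) ∘ φ(x)`. -/
def compTensor (φ : C →ₗ[K] A →ₗ[K] B) (ψ : D →ₗ[K] B →ₗ[K] F) : C ⊗[K] D →ₗ[K] A →ₗ[K] F :=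
  TensorProduct.lift ((LinearMap.llcomp K A B F).flip.compl₁₂ φ ψ)

omit [Coalgebra K C] [Coalgebra K D] in
theorem compTensor_tmul (φ : C →ₗ[K] A →ₗ[K] B) (ψ : D →ₗ[K] B →ₗ[K] F) (c : C) (d : D) :
    compTensor φ ψ (c ⊗ₜ d) = ψ d ∘ₗ φ c := by
  ext a
  simp [compTensor]

-- By linearity t is a pure tensor of elements v_i; then this is the measuring identity of ψ at the
-- elements φ(v_i)(a_i).
omit [Coalgebra K C] in
theorem actTensor_compTensor {φ : C →ₗ[K] A →ₗ[K] B} {ψ : D →ₗ[K] B →ₗ[K] F}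
    (hψ : IsMeasuring B F ψ) {n : ℕ} (hn : 1 ≤ n) (θ : O.obj n) (a : Fin n → A)
    (t : ⨂[K]^n C) (d : D) :
    actTensor (compTensor φ ψ) θ a (PiTensorProduct.map₂ (fun _ => TensorProduct.mk K C D) t
      (iterComul K D n d)) = ψ d (actTensor φ θ a t) := by
  induction t using PiTensorProduct.induction_on with
  | add s t hs ht => simp only [map_add, LinearMap.add_apply, hs, ht]
  | smul_tprod r v =>
    simp only [map_smul, LinearMap.smul_apply, actTensor_tprod]
    congr 1
    refine Eq.trans ?_ (hψ.map_act n hn d θ _).symm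
    change _ = actTensor ψ θ (fun i => φ (v i) (a i)) _
    generalize iterComul K D n d = s
    induction s using PiTensorProduct.induction_on with
    | add s t hs ht => simp only [map_add, hs, ht]
    | smul_tprod r v' =>
      simp only [map_smul, PiTensorProduct.map₂_tprod_tprod, actTensor_tprod,
        TensorProduct.mk_apply, compTensor_tmul, LinearMap.comp_apply]

theorem _root_.IsMeasuring.compTensor {φ : C →ₗ[K] A →ₗ[K] B} {ψ : D →ₗ[K] B →ₗ[K] F}
    (hφ : IsMeasuring A B φ) (hψ : IsMeasuring B F ψ) :
    IsMeasuring A F (compTensor φ ψ) := by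
  constructor
  · intro n hn t θ a
    change _ = actTensor (UniversalMeasuring.compTensor φ ψ) θ a _
    induction t with
    | zero => simp only [map_zero, LinearMap.zero_apply]
    | add s t hs ht => simp only [map_add, LinearMap.add_apply, hs, ht]
    | tmul c d =>
      rw [iterComul_tmul, actTensor_compTensor hψ hn, compTensor_tmul, LinearMap.comp_apply,
        hφ.map_act n hn]
      rfl
  · intro t θ
    induction t with
    | zero => simp only [map_zero, LinearMap.zero_apply, zero_smul]
    | add s t hs ht => simp only [map_add, LinearMap.add_apply, hs, ht, add_smul]
    | tmul c d =>
      rw [compTensor_tmul, LinearMap.comp_apply, hφ.map_u, map_smul, hψ.map_u, smul_smul,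
        TensorProduct.counit_tmul, smul_eq_mul, mul_comm]

/-- An algebra morphism is a measuring by the trivial coalgebra. -/
theorem isMeasuring_toSpanSingleton (f : A ⟶ B) :
    IsMeasuring A B (LinearMap.toSpanSingleton K (A →ₗ[K] B) f.toLinearMap) := by
  constructor
  · intro n hn c θ a
    change _ = actTensor _ θ a _
    have hc : c = c • (1 : K) := by simp
    rw [hc, map_smul, map_smul, map_smul, iterComul_one, actTensor_tprod]
    simp [f.map_act]
  · intro c θ
    have := f.map_act 0 θ Fin.elim0
    rw [LinearMap.toSpanSingleton_apply, LinearMap.smul_apply, OperadAlgebra.u, this]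
    congr 2
    exact Subsingleton.elim _ _

/-- The value at `1` of a measuring by the trivial coalgebra is an algebra morphism. -/
def homOfIsMeasuring {φ : K →ₗ[K] A →ₗ[K] B} (hφ : IsMeasuring A B φ) : A ⟶ B :=
  OperadAlgebra.Hom.mk (φ 1) fun n θ a => by
    -- Arity zero is governed by the separate condition on u, with ε(1) = 1.
    rcases n.eq_zero_or_pos with rfl | hn
    · have := hφ.map_u 1 θ
      rw [CommSemiring.counit_apply, one_smul] at this
      convert this using 2 <;> exact congrArg _ (Subsingleton.elim _ _)
    · refine (hφ.map_act n hn 1 θ a).trans ?_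
      change actTensor φ θ a _ = _
      rw [iterComul_one, actTensor_tprod]

/-! ### Construction of the universal measuring. -/

variable (A B) in
/-- A measuring whose coalgebra is a given quotient of a space of countable dimension. -/
structure CountableMeasuring where
  ker : Submodule K (ℕ →₀ K)
  coalgebra : Coalgebra K ((ℕ →₀ K) ⧸ ker)
  toHom : ((ℕ →₀ K) ⧸ ker) →ₗ[K] A →ₗ[K] B
  isMeasuring : IsMeasuring A B toHom

namespace CountableMeasuring

/-- The coalgebra of a countable measuring. -/
def Carrier (X : CountableMeasuring A B) : Type u := (ℕ →₀ K) ⧸ X.ker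

instance (X : CountableMeasuring A B) : AddCommGroup X.Carrier :=
  inferInstanceAs (AddCommGroup ((ℕ →₀ K) ⧸ X.ker))

instance (X : CountableMeasuring A B) : Module K X.Carrier :=
  inferInstanceAs (Module K ((ℕ →₀ K) ⧸ X.ker))

instance (X : CountableMeasuring A B) : Coalgebra K X.Carrier := X.coalgebra

/-- The measuring. -/
def hom (X : CountableMeasuring A B) : X.Carrier →ₗ[K] A →ₗ[K] B := X.toHom

end CountableMeasuring

open Classical in
variable (A B) in
/-- The evaluation on the direct sum of all countable measurings. -/
def sumEval : (Π₀ X : CountableMeasuring A B, X.Carrier) →ₗ[K] A →ₗ[K] B :=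
  DFinsupp.lsum K fun X : CountableMeasuring A B => X.hom

open Classical in
variable (A B) in
/-- The universal measuring coalgebra. -/
def MeasuringCoalgebra : Type u :=
  (Π₀ X : CountableMeasuring A B, X.Carrier) ⧸ maxCoideal (sumEval A B)

namespace MeasuringCoalgebra

open Classical in
instance : AddCommGroup (MeasuringCoalgebra A B) :=
  inferInstanceAs (AddCommGroup
    ((Π₀ X : CountableMeasuring A B, X.Carrier) ⧸ maxCoideal (sumEval A B)))

open Classical in
instance : Module K (MeasuringCoalgebra A B) :=
  inferInstanceAs (Module K
    ((Π₀ X : CountableMeasuring A B, X.Carrier) ⧸ maxCoideal (sumEval A B)))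

open Classical in
instance : Coalgebra K (MeasuringCoalgebra A B) :=
  inferInstanceAs (Coalgebra K
    ((Π₀ X : CountableMeasuring A B, X.Carrier) ⧸ maxCoideal (sumEval A B)))

variable (A B) in
/-- The universal measuring. -/
def eval : MeasuringCoalgebra A B →ₗ[K] A →ₗ[K] B := by
  classical exact maxCoidealLift (sumEval A B)

theorem maxCoideal_eval : maxCoideal (eval A B) = ⊥ := by
  classical exact maxCoideal_maxCoidealLift (sumEval A B)

open Classical in
variable (A B) in
/-- The projection from the direct sum of all countable measurings. -/
def proj : (Π₀ X : CountableMeasuring A B, X.Carrier) →ₗc[K] MeasuringCoalgebra A B :=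
  Coalgebra.Quotient.mkQCoalgHom (R := K) (maxCoideal (sumEval A B))

theorem proj_surjective : Function.Surjective (proj A B) := by
  classical
  exact Submodule.Quotient.mk_surjective (maxCoideal (sumEval A B))

theorem eval_proj (x : Π₀ X : CountableMeasuring A B, X.Carrier) :
    eval A B (proj A B x) = sumEval A B x := by
  classical
  exact LinearMap.congr_fun (maxCoidealLift_comp_mkQ (sumEval A B)) x

open Classical in
/-- The coalgebra map from a countable measuring to the universal one. -/
def ofCountable (X : CountableMeasuring A B) : X.Carrier →ₗc[K] MeasuringCoalgebra A B :=
  (proj A B).comp (lsingleCoalgHom (fun X : CountableMeasuring A B => X.Carrier) X)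

theorem eval_comp_ofCountable (X : CountableMeasuring A B) :
    eval A B ∘ₗ (ofCountable X : X.Carrier →ₗ[K] MeasuringCoalgebra A B) = X.hom := by
  classical
  refine LinearMap.ext fun x => (eval_proj (DFinsupp.single X x)).trans ?_
  exact DFinsupp.lsum_single (S := K) (fun X : CountableMeasuring A B => X.hom) X x

theorem span_range_ofCountable :
    Submodule.span K (⋃ X : CountableMeasuring A B, Set.range (ofCountable X)) = ⊤ := by
  classical
  refine eq_top_iff.2 fun y _ => ?_
  obtain ⟨x, rfl⟩ := proj_surjective y
  induction x using DFinsupp.induction with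
  | h0 => rw [map_zero]; exact zero_mem _
  | ha X b f _ _ ih =>
    rw [map_add]
    exact add_mem (Submodule.subset_span (Set.mem_iUnion.2 ⟨X, b, rfl⟩)) (ih trivial)

/-- The images of the countable measurings span, and the restriction to each of them is a measuring.
-/
theorem isMeasuring_eval : IsMeasuring A B (eval A B) := by
  refine isMeasuring_of_forall_mem_span span_range_ofCountable fun c hc => ?_
  obtain ⟨X, hX⟩ := Set.mem_iUnion.1 hc
  exact ⟨X.Carrier, _, _, _, ofCountable X, hX, by
    rw [eval_comp_ofCountable]; exact X.isMeasuring⟩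

theorem isUniversalMeasuring_eval : IsUniversalMeasuring A B (eval A B) where
  isMeasuring := isMeasuring_eval
  existsUnique C _ _ _ φ hφ := by
    refine existsUnique_coalgHom (E := fun X : CountableMeasuring A B => X.Carrier)
      maxCoideal_eval ofCountable fun c => ?_
    obtain ⟨N, hN, f, hc⟩ := exists_coalgHom_of_countable (K := K) c
    let X : CountableMeasuring A B := ⟨N, hN, _, hφ.comp_coalgHom f⟩
    exact ⟨X, f, hc, (eval_comp_ofCountable X).symm⟩

end MeasuringCoalgebra

end Measurings

/-! ### The enrichment and the bialgebra structure. -/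

section Composition

variable {K : Type u} [Field K] {O : Operad.{w} K} {A B D F : OperadAlgebra O}

/-- Turns compatibility of the composition with Δ into Δ(xy) = Δ(x)Δ(y). -/
theorem map_mul'_tensorTensorTensorComm {R H : Type*} [CommSemiring R] [Semiring H] [Algebra R H]
    (s t : H ⊗[R] H) :
    TensorProduct.map (LinearMap.mul' R H) (LinearMap.mul' R H)
      (AlgebraTensorModule.tensorTensorTensorComm R R R R H H H H (s ⊗ₜ t)) = s * t := by
  induction s with
  | zero => simp
  | add s s' hs hs' => rw [TensorProduct.add_tmul, map_add, map_add, add_mul, hs, hs']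
  | tmul a₁ a₂ =>
    induction t with
    | zero => simp
    | add t t' ht ht' => rw [TensorProduct.tmul_add, map_add, map_add, mul_add, ht, ht']
    | tmul b₁ b₂ => simp

namespace MeasuringCoalgebra

theorem coalgHom_ext {C : Type u} [AddCommGroup C] [Module K C] [Coalgebra K C]
    {f g : C →ₗc[K] MeasuringCoalgebra A B} (h : ∀ c, eval A B (f c) = eval A B (g c)) : f = g :=
  coalgHom_eq_of_comp_eq maxCoideal_eval (LinearMap.ext h)

/-- The coalgebra map to the universal measuring coalgebra induced by a measuring. -/
def lift {C : Type u} [AddCommGroup C] [Module K C] [Coalgebra K C] {φ : C →ₗ[K] A →ₗ[K] B}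
    (hφ : IsMeasuring A B φ) : C →ₗc[K] MeasuringCoalgebra A B :=
  (isUniversalMeasuring_eval.existsUnique C φ hφ).choose

theorem eval_lift {C : Type u} [AddCommGroup C] [Module K C] [Coalgebra K C]
    {φ : C →ₗ[K] A →ₗ[K] B} (hφ : IsMeasuring A B φ) (c : C) :
    eval A B (lift hφ c) = φ c :=
  LinearMap.congr_fun (isUniversalMeasuring_eval.existsUnique C φ hφ).choose_spec.1 c

variable (A B D) in
/-- The composition of universal measuring coalgebras. -/
def comp : MeasuringCoalgebra A B ⊗[K] MeasuringCoalgebra B D →ₗc[K] MeasuringCoalgebra A D :=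
  lift (isMeasuring_eval.compTensor isMeasuring_eval)

theorem eval_comp (x : MeasuringCoalgebra A B) (y : MeasuringCoalgebra B D) :
    eval A D (comp A B D (x ⊗ₜ y)) = eval B D y ∘ₗ eval A B x := by
  rw [comp, eval_lift, compTensor_tmul]

/-- The coalgebra map from the trivial coalgebra associated with an algebra morphism. -/
def ofHom (f : A ⟶ B) : K →ₗc[K] MeasuringCoalgebra A B :=
  lift (isMeasuring_toSpanSingleton f)

theorem eval_ofHom (f : A ⟶ B) : eval A B (ofHom f 1) = f.toLinearMap := by
  rw [ofHom, eval_lift, LinearMap.toSpanSingleton_apply, one_smul]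

theorem ofHom_eq_iff {f : A ⟶ B} {g : K →ₗc[K] MeasuringCoalgebra A B} :
    ofHom f = g ↔ f.toLinearMap = eval A B (g 1) := by
  refine ⟨fun h => by rw [← h, eval_ofHom], fun h => coalgHom_ext fun c => ?_⟩
  have hc : c = c • (1 : K) := by simp
  rw [hc, map_smul, map_smul, map_smul, map_smul, eval_ofHom, h]

/-- Algebra morphisms correspond to coalgebra maps from the trivial coalgebra. -/
def homEquiv : (A ⟶ B) ≃ (K →ₗc[K] MeasuringCoalgebra A B) where
  toFun := ofHom
  invFun g := homOfIsMeasuring (isMeasuring_eval.comp_coalgHom g)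
  left_inv f := OperadAlgebra.Hom.ext (eval_ofHom f)
  right_inv _ := ofHom_eq_iff.2 rfl

variable (A) in
/-- The unit of the composition. -/
def unit : K →ₗc[K] MeasuringCoalgebra A A := ofHom (𝟙 A)

theorem eval_unit : eval A A (unit A 1) = LinearMap.id := eval_ofHom _

/-- Composition with the unit is a coalgebra endomorphism, being M ≅ K ⊗ M → M ⊗ M' → M' with M' = M
up to the choice of Hom-object, so evaluation suffices to compare it with the identity. -/
theorem unit_comp (x : MeasuringCoalgebra A B) : comp A A B (unit A 1 ⊗ₜ x) = x := by
  let f : MeasuringCoalgebra A B →ₗc[K] MeasuringCoalgebra A B :=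
    ((comp A A B).comp ((unit A).rTensor _)).comp ((Coalgebra.TensorProduct.lid K (MeasuringCoalgebra A B)).symm : _ →ₗc[K] _)
  have : f = CoalgHom.id K _ := coalgHom_ext fun c => by
    change eval A B (comp A A B (unit A 1 ⊗ₜ c)) = eval A B c
    rw [eval_comp, eval_unit, LinearMap.comp_id]
  exact CoalgHom.congr_fun this x

theorem comp_unit (x : MeasuringCoalgebra A B) : comp A B B (x ⊗ₜ unit B 1) = x := by
  let f : MeasuringCoalgebra A B →ₗc[K] MeasuringCoalgebra A B :=
    ((comp A B B).comp ((unit B).lTensor _)).comp ((Coalgebra.TensorProduct.rid K K (MeasuringCoalgebra A B)).symm : _ →ₗc[K] _)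
  have : f = CoalgHom.id K _ := coalgHom_ext fun c => by
    change eval A B (comp A B B (c ⊗ₜ unit B 1)) = eval A B c
    rw [eval_comp, eval_unit, LinearMap.id_comp]
  exact CoalgHom.congr_fun this x

theorem comp_assoc (x : MeasuringCoalgebra A B) (y : MeasuringCoalgebra B D)
    (z : MeasuringCoalgebra D F) :
    comp A D F (comp A B D (x ⊗ₜ y) ⊗ₜ z) = comp A B F (x ⊗ₜ comp B D F (y ⊗ₜ z)) := by
  let f : (MeasuringCoalgebra A B ⊗[K] MeasuringCoalgebra B D) ⊗[K] MeasuringCoalgebra D F →ₗc[K]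
      MeasuringCoalgebra A F := (comp A D F).comp ((comp A B D).rTensor _)
  let g : (MeasuringCoalgebra A B ⊗[K] MeasuringCoalgebra B D) ⊗[K] MeasuringCoalgebra D F →ₗc[K]
      MeasuringCoalgebra A F := ((comp A B F).comp ((comp B D F).lTensor _)).comp
        (Coalgebra.TensorProduct.assoc K K (MeasuringCoalgebra A B) (MeasuringCoalgebra B D)
          (MeasuringCoalgebra D F) : _ →ₗc[K] _)
  have : f = g := coalgHom_ext fun t => by
    have h : eval A F ∘ₗ f.toLinearMap = eval A F ∘ₗ g.toLinearMap := by
      refine TensorProduct.ext_threefold fun a b c => ?_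
      change eval A F (comp A D F (comp A B D (a ⊗ₜ b) ⊗ₜ c)) =
        eval A F (comp A B F (a ⊗ₜ comp B D F (b ⊗ₜ c)))
      rw [eval_comp, eval_comp, eval_comp, eval_comp, LinearMap.comp_assoc]
    exact LinearMap.congr_fun h t
  exact CoalgHom.congr_fun this ((x ⊗ₜ y) ⊗ₜ z)

theorem ofHom_comp (f : A ⟶ B) (g : B ⟶ D) :
    ofHom (f ≫ g) 1 = comp A B D (ofHom f 1 ⊗ₜ ofHom g 1) := by
  let h : K →ₗc[K] MeasuringCoalgebra A D :=
    ((comp A B D).comp (Coalgebra.TensorProduct.map (ofHom f) (ofHom g))).comp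
      (Coalgebra.TensorProduct.lid K K).symm
  have : ofHom (f ≫ g) = h := ofHom_eq_iff.2 <| by
    change _ = eval A D (comp A B D (ofHom f 1 ⊗ₜ ofHom g 1))
    rw [eval_comp, eval_ofHom, eval_ofHom]
    rfl
  exact CoalgHom.congr_fun this 1

/-- The product follows the order of the enriched composition, so evaluation reverses products: x *
y acts as x followed by y. -/
instance : Ring (MeasuringCoalgebra A A) where
  __ := (inferInstance : AddCommGroup (MeasuringCoalgebra A A))
  mul x y := comp A A A (x ⊗ₜ y)
  one := unit A 1
  zero_mul x := (congrArg _ (TensorProduct.zero_tmul _ x)).trans (map_zero (comp A A A))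
  mul_zero x := (congrArg _ (TensorProduct.tmul_zero _ x)).trans (map_zero (comp A A A))
  left_distrib x y z :=
    (congrArg _ (TensorProduct.tmul_add x y z)).trans (map_add (comp A A A) _ _)
  right_distrib x y z :=
    (congrArg _ (TensorProduct.add_tmul x y z)).trans (map_add (comp A A A) _ _)
  mul_assoc := comp_assoc
  one_mul := unit_comp
  mul_one := comp_unit

theorem mul_def (x y : MeasuringCoalgebra A A) : x * y = comp A A A (x ⊗ₜ y) := rfl

theorem one_def : (1 : MeasuringCoalgebra A A) = unit A 1 := rfl

instance : Algebra K (MeasuringCoalgebra A A) where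
  -- The existing scalar action is kept, so that the algebra and the coalgebra share one module
  -- structure.
  smul := (· • ·)
  algebraMap :=
    { toFun r := r • 1
      map_one' := one_smul K 1
      map_mul' r s := by
        rw [mul_def, TensorProduct.smul_tmul_smul, map_smul, ← mul_def, one_mul]
      map_zero' := zero_smul K 1
      map_add' r s := add_smul r s 1 }
  commutes' r x := by
    change r • 1 * x = x * r • 1
    rw [mul_def, mul_def, TensorProduct.smul_tmul, TensorProduct.tmul_smul,
      TensorProduct.tmul_smul, map_smul, map_smul, ← mul_def, ← mul_def, one_mul, mul_one]
  smul_def' r x := by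
    change r • x = r • 1 * x
    rw [mul_def, TensorProduct.smul_tmul, TensorProduct.tmul_smul, map_smul, ← mul_def, one_mul]

theorem toLinearMap_comp : (comp A A A : MeasuringCoalgebra A A ⊗[K] MeasuringCoalgebra A A →ₗ[K]
    MeasuringCoalgebra A A) = LinearMap.mul' K (MeasuringCoalgebra A A) :=
  TensorProduct.ext' fun _ _ => rfl

/-- The four compatibilities say exactly that the composition and the unit are coalgebra maps. -/
instance : Bialgebra K (MeasuringCoalgebra A A) :=
  Bialgebra.mk' K (MeasuringCoalgebra A A)
    (by
      rw [one_def]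
      exact CoalgHomClass.counit_comp_apply (unit A) 1)
    (by
      intro a b
      rw [mul_def]
      refine (CoalgHomClass.counit_comp_apply (comp A A A) _).trans ?_
      rw [TensorProduct.counit_tmul, smul_eq_mul, mul_comm])
    (by
      rw [one_def]
      exact (CoalgHomClass.map_comp_comul_apply (unit A) 1).symm)
    (by
      intro a b
      rw [mul_def]
      refine (CoalgHomClass.map_comp_comul_apply (comp A A A) _).symm.trans ?_
      rw [TensorProduct.comul_tmul]
      rw [toLinearMap_comp, map_mul'_tensorTensorTensorComm])

end MeasuringCoalgebra

open MeasuringCoalgebra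

/-- The category of `O`-algebras, enriched over coalgebras by universal measuring coalgebras. -/
@[reducible]
def enrichedOrdinaryCategory (O : Operad.{w} K) :
    EnrichedOrdinaryCategory (CoalgCat.{u} K) (OperadAlgebra O) where
  Hom A B := CoalgCat.of K (MeasuringCoalgebra A B)
  id A := CoalgCat.ofHom (unit A)
  comp A B D := CoalgCat.ofHom (comp A B D)
  id_comp _ _ := CoalgCat.hom_ext _ _ (CoalgHom.ext unit_comp)
  comp_id _ _ := CoalgCat.hom_ext _ _ (CoalgHom.ext comp_unit)
  assoc _ _ _ _ := CoalgCat.hom_ext _ _ <| CoalgHom.coe_linearMap_injective <|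
    TensorProduct.ext <| LinearMap.ext fun x => TensorProduct.ext' fun y z => comp_assoc x y z
  homEquiv := homEquiv.trans
    ⟨fun f => CoalgCat.ofHom f, fun f => f.toCoalgHom, fun _ => rfl, fun _ => rfl⟩
  homEquiv_id _ := rfl
  homEquiv_comp f g := CoalgCat.hom_ext _ _ (CoalgHom.ext_of_ring (ofHom_comp f g))

end Composition

end UniversalMeasuring

end

open UniversalMeasuring MeasuringCoalgebra in
theorem theorem5p4 {K : Type u} [Field K] (O : Operad.{w} K) :
    ∃ (E : EnrichedOrdinaryCategory (CoalgCat.{u} K) (OperadAlgebra O))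
      (Φ : ∀ A B : OperadAlgebra O, E.Hom A B →ₗ[K] A →ₗ[K] B),
      -- the Hom-objects are universal measuring coalgebras
      (∀ A B : OperadAlgebra O, IsUniversalMeasuring A B (Φ A B)) ∧
      -- the composition is induced by the composition of linear maps
      (∀ (A B D : OperadAlgebra O) (x : E.Hom A B) (y : E.Hom B D),
        Φ A D ((E.comp A B D).toCoalgHom (x ⊗ₜ[K] y)) = Φ B D y ∘ₗ Φ A B x) ∧
      -- the unit is induced by the identity map
      (∀ A : OperadAlgebra O, Φ A A ((E.id A).toCoalgHom (1 : K)) = LinearMap.id) ∧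
      -- the underlying category is the category of `O`-algebras, compatibly with `Φ`
      (∀ (A B : OperadAlgebra O) (f : A ⟶ B),
        Φ A B ((E.homEquiv f).toCoalgHom (1 : K)) = f.toLinearMap) ∧
      -- the coalgebra `M(A, A)`, with the composition as product, is a bialgebra
      (∀ A : OperadAlgebra O, ∃ (H : Type u) (_ : Ring H) (_ : Bialgebra K H)
        (e : H ≃ₗc[K] E.Hom A A),
        (∀ x y : H, e (x * y) = (E.comp A A A).toCoalgHom (e x ⊗ₜ[K] e y)) ∧
        e 1 = (E.id A).toCoalgHom (1 : K)) :=
  ⟨enrichedOrdinaryCategory O, fun A B => eval A B, fun _ _ => isUniversalMeasuring_eval,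
    fun _ _ _ x y => eval_comp x y, fun _ => eval_unit, fun _ _ f => eval_ofHom f,
    fun A => ⟨MeasuringCoalgebra A A, inferInstance, inferInstance,
      CoalgEquiv.refl K (MeasuringCoalgebra A A), fun _ _ => rfl, rfl⟩⟩
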